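/- Let $K$ be a field, $S=K[x_1,\dots,x_n]$, and let $I\subseteq S$ be a monomial ideal. Let $G(I)$ be the minimal set of monomial generators of $I$, let $\deg(I)$ be the highest degree of a monomial in $G(I)$, and let $m(I)=\max_{u\in G(I)} m(u)$, where $m(u)=\max\{i : x_i\mid u\}$ for a monomial $u\neq 1$ and $m(1)=0$ (for $I=0$ put $\deg(I)=m(I)=0$). Let $\beta_{ij}(I)$ be the graded Betti numbers of $I$, i.e. the number of basis elements of degree $j$ in homological degree $i$ of a minimal graded free resolution of $I$ over $S$, and let $\operatorname{reg}(I)=\max\{j-i : \beta_{ij}(I)\neq 0\}$ (with $\operatorname{reg}(0)=-\infty$). If the set $\operatorname{Ass}(S/I)$ of associated primes of $S/I$ is totally ordered by inclusion, then $$\operatorname{reg}(I)\le m(I)\,(\deg(I)-1)+1 .$$ Moreover, after a suitable permutation of the variables $I$ becomes an ideal of Borel type, that is, there is a permutation $\sigma$ of $\{1,\dots,n\}$ such that the image $I'$ of $I$ under $x_i\mapsto x_{\sigma(i)}$ satisfies $(I':x_j^\infty)=(I':(x_1,\dots,x_j)^\infty)$ for all $j=1,\dots,n$. -/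

import Mathlib

open MvPolynomial

namespace BorelReg

noncomputable section

/-- `I` is a monomial ideal: it is generated by a set of monomials (given by exponent vectors). -/
def IsMonomialIdeal {K : Type*} [Field K] {n : ℕ} (I : Ideal (MvPolynomial (Fin n) K)) : Prop :=
  ∃ A : Set (Fin n →₀ ℕ), I = Ideal.span ((fun a => (monomial a (1 : K))) '' A)

/-- The exponent vectors of the minimal monomial generators `G(I)`: the monomials of `I` that are
minimal for divisibility among the monomials of `I`. -/
def minGens {K : Type*} [Field K] {n : ℕ} (I : Ideal (MvPolynomial (Fin n) K)) :
    Set (Fin n →₀ ℕ) :=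
  {a | Minimal (fun b : Fin n →₀ ℕ => monomial b (1 : K) ∈ I) a}

theorem minGens_finite {K : Type*} [Field K] {n : ℕ} (I : Ideal (MvPolynomial (Fin n) K)) :
    (minGens I).Finite :=
  (setOfPred_minimal_antichain _).finite_of_partiallyWellOrderedOn
    (Set.isPWO_of_wellQuasiOrderedLE _)

/-- `deg(I)`: the highest degree of a minimal monomial generator. -/
def genDeg {K : Type*} [Field K] {n : ℕ} (I : Ideal (MvPolynomial (Fin n) K)) : ℕ :=
  (minGens_finite I).toFinset.sup fun a => a.degree

/-- `m(u)` for the monomial `u` with exponent vector `a`: the largest position (counted from `1`)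
of a variable dividing `u`, and `0` for `u = 1`. -/
def maxVar {n : ℕ} (a : Fin n →₀ ℕ) : ℕ :=
  a.support.sup fun i => (i : ℕ) + 1

/-- `m(I)`: the maximum of `m(u)` over the minimal monomial generators `u` of `I`. -/
def maxVarIdeal {K : Type*} [Field K] {n : ℕ} (I : Ideal (MvPolynomial (Fin n) K)) : ℕ :=
  (minGens_finite I).toFinset.sup maxVar

/-- A minimal graded free resolution
`⋯ → F₁ → F₀ → I → 0` with `Fᵢ = ⨁_b S(-deg i b)`, `b` running over a basis of size `rank i`.
The maps are homogeneous of degree `0`: in each entry of the matrix of a map, only monomials occur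
whose degree is the difference of the degrees of the two basis elements. -/
structure MinGradedFreeRes {K : Type*} [Field K] {n : ℕ}
    (I : Ideal (MvPolynomial (Fin n) K)) where
  rank : ℕ → ℕ
  deg : (i : ℕ) → Fin (rank i) → ℕ
  diff : (i : ℕ) → (Fin (rank (i + 1)) → MvPolynomial (Fin n) K) →ₗ[MvPolynomial (Fin n) K]
    (Fin (rank i) → MvPolynomial (Fin n) K)
  aug : (Fin (rank 0) → MvPolynomial (Fin n) K) →ₗ[MvPolynomial (Fin n) K] MvPolynomial (Fin n) K
  diff_homogeneous : ∀ (i : ℕ) (b : Fin (rank (i + 1))) (c : Fin (rank i)),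
    ∀ a ∈ (diff i (Pi.single b 1) c).support, deg i c + a.degree = deg (i + 1) b
  aug_homogeneous : ∀ b : Fin (rank 0), ∀ a ∈ (aug (Pi.single b 1)).support, a.degree = deg 0 b
  range_aug : LinearMap.range aug = I
  exact_aug : Function.Exact (diff 0) aug
  exact_diff : ∀ i : ℕ, Function.Exact (diff (i + 1)) (diff i)
  minimal : ∀ (i : ℕ) (v : Fin (rank (i + 1)) → MvPolynomial (Fin n) K) (c : Fin (rank i)),
    diff i v c ∈ Ideal.span (Set.range (X : Fin n → MvPolynomial (Fin n) K))

open Classical in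
/-- The graded Betti number `β_{ij}(I)`: the number of basis elements of degree `j` in homological
degree `i` of a minimal graded free resolution of `I`. Such a resolution exists and is unique up to
isomorphism for every homogeneous ideal, in particular for every monomial ideal. -/
def gradedBetti {K : Type*} [Field K] {n : ℕ} (I : Ideal (MvPolynomial (Fin n) K))
    (i j : ℕ) : ℕ :=
  if h : Nonempty (MinGradedFreeRes I) then
    (Finset.univ.filter fun b => h.some.deg i b = j).card
  else 0

/-- The regularity `max {j - i | β_{ij}(I) ≠ 0}`, as a supremum in `ℤ ∪ {±∞}`
(so it is `-∞` for the zero ideal). -/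
def regularity {K : Type*} [Field K] {n : ℕ} (I : Ideal (MvPolynomial (Fin n) K)) :
    WithBot (WithTop ℤ) :=
  sSup {r | ∃ i j : ℕ, gradedBetti I i j ≠ 0 ∧ r = (((j : ℤ) - (i : ℤ) : ℤ) : WithTop ℤ)}

/-- The saturation `(I : J^∞) = ⋃ₖ (I : J^k)`; the union is increasing, hence equal to the
supremum. -/
def saturation {R : Type*} [CommRing R] (I J : Ideal R) : Ideal R :=
  ⨆ k : ℕ, Submodule.colon I ((J ^ k : Ideal R) : Set R)

/-- `I` is of Borel type: `(I : x_j^∞) = (I : (x_1, …, x_j)^∞)` for all `j`. -/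
def IsBorelType {K : Type*} [Field K] {n : ℕ} (I : Ideal (MvPolynomial (Fin n) K)) : Prop :=
  ∀ j : Fin n,
    saturation I (Ideal.span {X j}) =
      saturation I (Ideal.span ((fun i => (X i : MvPolynomial (Fin n) K)) '' {i | i ≤ j}))

end

end BorelReg

/-!
`I` is of Borel type exactly when every polynomial `f` multiplied into `I` by a power of `x_j` is
also multiplied into `I` by a power of each `x_i` with `i ≤ j`. The primes minimal over `(I : f)`
are associated to `S / I`, so it suffices to sort the variables by the set of associated primes
that avoid them, and these sets form a chain.

Suppose now that `I` is of Borel type after sorting. If a monomial `u ∉ I`, not divisible by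
`x_{j+1}, …, x_n`, is multiplied into `I` by `x_j`, then powers of `x_1, …, x_j` all multiply it
into `I`, hence every variable dividing `u` has exponent at most `deg(I) - 1` in `u` and is one of
the at most `m(I)` variables occurring in generators. Thus `x_n, …, x_1` is a regular sequence on
`S / I` in degrees `> m(I) (deg(I) - 1)`. This property passes to syzygy modules with the bound
raised by one, and it bounds the degrees of the minimal generators at each step of a resolution.
-/

namespace BorelReg

section GradedFreeModule

variable {R τ ι κ : Type*}

section CommSemiring

variable [CommSemiring R]

/-- `v` is homogeneous of degree `e` in the graded free module `⨁_b S(-d b)`. The grading is given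
through monomials, as in `MinGradedFreeRes`. -/
def IsHomogeneousVec (d : ι → ℕ) (e : ℕ) (v : ι → MvPolynomial τ R) : Prop :=
  ∀ b, ∀ a ∈ (v b).support, d b + a.degree = e

/-- The projection of the graded free module `⨁_b S(-d b)` onto its homogeneous component of
degree `e`. Coordinates with `d b > e` are set to zero explicitly, since `e - d b` truncates. -/
noncomputable def gradedComp (d : ι → ℕ) (e : ℕ) :
    (ι → MvPolynomial τ R) →ₗ[R] (ι → MvPolynomial τ R) :=
  LinearMap.pi fun b =>
    (if d b ≤ e then homogeneousComponent (e - d b) else 0) ∘ₗ LinearMap.proj b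

/-- The map `φ : ⨁_b S(-dG b) → ⨁_c S(-dF c)` is homogeneous of degree `0`, stated on the standard
basis. -/
def IsHomogeneousMap [DecidableEq ι] (dG : ι → ℕ) (dF : κ → ℕ)
    (φ : (ι → MvPolynomial τ R) →ₗ[MvPolynomial τ R] (κ → MvPolynomial τ R)) : Prop :=
  ∀ b, IsHomogeneousVec dF (dG b) (φ (Pi.single b 1))

variable {d : ι → ℕ} {e : ℕ} {v : ι → MvPolynomial τ R}

theorem coeff_gradedComp (d : ι → ℕ) (e : ℕ) (v : ι → MvPolynomial τ R) (b : ι) (a : τ →₀ ℕ) :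
    coeff a (gradedComp d e v b) = if d b + a.degree = e then coeff a (v b) else 0 := by
  simp only [gradedComp, LinearMap.pi_apply, LinearMap.comp_apply, LinearMap.proj_apply]
  by_cases h : d b ≤ e
  · rw [if_pos h, coeff_homogeneousComponent]
    exact if_congr (by omega) rfl rfl
  · rw [if_neg h, if_neg (by omega), LinearMap.zero_apply, coeff_zero]

theorem isHomogeneousVec_iff_gradedComp_eq : IsHomogeneousVec d e v ↔ gradedComp d e v = v := by
  simp only [IsHomogeneousVec, funext_iff, MvPolynomial.ext_iff, coeff_gradedComp, mem_support_iff,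
    ite_eq_left_iff]
  exact forall₂_congr fun b a => by rw [not_imp_comm, @eq_comm _ 0]

theorem isHomogeneousVec_gradedComp (d : ι → ℕ) (e : ℕ) (v : ι → MvPolynomial τ R) :
    IsHomogeneousVec d e (gradedComp d e v) := by
  intro b a ha
  rw [mem_support_iff, coeff_gradedComp] at ha
  exact of_not_not fun h => ha (if_neg h)

theorem isHomogeneousVec_single [DecidableEq ι] (d : ι → ℕ) (b : ι) :
    IsHomogeneousVec d (d b) (Pi.single b 1 : ι → MvPolynomial τ R) := by
  intro c a ha
  obtain rfl | hcb := eq_or_ne c b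
  · rw [Pi.single_eq_same, ← C_1] at ha
    rw [Finset.mem_singleton.1 (support_monomial_subset ha), map_zero, add_zero]
  · simp [Pi.single_eq_of_ne hcb] at ha

theorem gradedComp_X_smul (d : ι → ℕ) (e : ℕ) (i : τ) (v : ι → MvPolynomial τ R) :
    gradedComp d (e + 1) ((X i : MvPolynomial τ R) • v) =
      (X i : MvPolynomial τ R) • gradedComp d e v := by
  classical
  ext b a
  simp only [coeff_gradedComp, Pi.smul_apply, smul_eq_mul, coeff_X_mul']
  by_cases hi : i ∈ a.support
  · have hdeg : a.degree = (a - Finsupp.single i 1).degree + 1 := by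
      have hle : Finsupp.single i 1 ≤ a :=
        Finsupp.single_le_iff.2 (Nat.one_le_iff_ne_zero.2 (Finsupp.mem_support_iff.1 hi))
      conv_lhs => rw [← tsub_add_cancel_of_le hle]
      rw [map_add, Finsupp.degree_single]
    simp only [hi, if_true, hdeg]
    exact if_congr (by omega) rfl rfl
  · simp only [hi, if_false, ite_self]

theorem IsHomogeneousVec.X_smul (hv : IsHomogeneousVec d e v) (i : τ) :
    IsHomogeneousVec d (e + 1) ((X i : MvPolynomial τ R) • v) := by
  rw [isHomogeneousVec_iff_gradedComp_eq, gradedComp_X_smul,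
    isHomogeneousVec_iff_gradedComp_eq.1 hv]

theorem IsHomogeneousMap.map_gradedComp [Finite ι] [DecidableEq ι] {dG : ι → ℕ} {dF : κ → ℕ}
    {φ : (ι → MvPolynomial τ R) →ₗ[MvPolynomial τ R] (κ → MvPolynomial τ R)}
    (hφ : IsHomogeneousMap dG dF φ) (e : ℕ) (v : ι → MvPolynomial τ R) :
    φ (gradedComp dG e v) = gradedComp dF e (φ v) := by
  classical
  cases nonempty_fintype ι
  have hφ_apply : ∀ (w : ι → MvPolynomial τ R) (c : κ), φ w c = ∑ b, w b * φ (Pi.single b 1) c := by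
    intro w c
    conv_lhs => rw [pi_eq_sum_univ' w]
    simp only [map_sum, map_smul, Finset.sum_apply, Pi.smul_apply, smul_eq_mul]
  ext c a
  rw [coeff_gradedComp, hφ_apply (gradedComp dG e v), hφ_apply v]
  simp only [coeff_gradedComp, coeff_sum, coeff_mul, Finset.ite_sum_zero, ite_mul, zero_mul]
  refine Finset.sum_congr rfl fun b _ => Finset.sum_congr rfl fun p hp => ?_
  by_cases hb : coeff p.2 (φ (Pi.single b 1) c) = 0
  · simp only [hb, mul_zero, ite_self]
  · have hdeg : dF c + p.2.degree = dG b := hφ b c p.2 (mem_support_iff.2 hb)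
    refine if_congr ?_ rfl rfl
    rw [← Finset.HasAntidiagonal.mem_antidiagonal.1 hp, map_add]
    omega

theorem IsHomogeneousMap.isHomogeneousVec_map [Finite ι] [DecidableEq ι] {dG : ι → ℕ} {dF : κ → ℕ}
    {φ : (ι → MvPolynomial τ R) →ₗ[MvPolynomial τ R] (κ → MvPolynomial τ R)}
    (hφ : IsHomogeneousMap dG dF φ) (hv : IsHomogeneousVec dG e v) :
    IsHomogeneousVec dF e (φ v) := by
  rw [isHomogeneousVec_iff_gradedComp_eq, ← hφ.map_gradedComp,
    isHomogeneousVec_iff_gradedComp_eq.1 hv]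

/-- The elements of the free module `S^ι` all of whose coordinates lie in the ideal generated by
the variables in `T`. -/
noncomputable def varsSubmodule (R ι : Type*) {τ : Type*} [CommSemiring R] (T : Set τ) :
    Submodule (MvPolynomial τ R) (ι → MvPolynomial τ R) :=
  Submodule.pi Set.univ fun _ => Ideal.span (X '' T)

variable {T : Set τ} {i : τ}

theorem mem_varsSubmodule :
    v ∈ varsSubmodule R ι T ↔ ∀ b, v b ∈ Ideal.span (X '' T : Set (MvPolynomial τ R)) := by
  simp only [varsSubmodule, Submodule.mem_pi, Set.mem_univ, true_implies]

theorem mem_varsSubmodule_iff_support :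
    v ∈ varsSubmodule R ι T ↔ ∀ b, ∀ a ∈ (v b).support, ∃ i ∈ T, a i ≠ 0 :=
  mem_varsSubmodule.trans (forall_congr' fun _ => mem_ideal_span_X_image)

theorem varsSubmodule_empty : varsSubmodule R ι (∅ : Set τ) = ⊥ := by
  simp [varsSubmodule]

theorem varsSubmodule_mono {T T' : Set τ} (h : T ⊆ T') :
    varsSubmodule R ι T ≤ varsSubmodule R ι T' :=
  Submodule.pi_mono fun _ _ => Ideal.span_mono (Set.image_mono h)

theorem pi_sup_varsSubmodule (I : Ideal (MvPolynomial τ R)) (T : Set τ) :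
    Submodule.pi Set.univ (fun _ : ι => I) ⊔ varsSubmodule R ι T =
      Submodule.pi Set.univ fun _ => I ⊔ Ideal.span (X '' T) := by
  refine le_antisymm (sup_le (Submodule.pi_mono fun _ _ => le_sup_left)
    (Submodule.pi_mono fun _ _ => le_sup_right)) fun v hv => ?_
  choose f hf g hg hfg using fun b => Submodule.mem_sup.1 (hv b (Set.mem_univ b))
  exact Submodule.mem_sup.2 ⟨f, fun b _ => hf b, g, fun b _ => hg b, funext hfg⟩

theorem X_smul_mem_varsSubmodule (hi : i ∈ T) (v : ι → MvPolynomial τ R) :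
    (X i : MvPolynomial τ R) • v ∈ varsSubmodule R ι T :=
  mem_varsSubmodule.2 fun _ => Ideal.mul_mem_right _ _ (Ideal.subset_span ⟨i, hi, rfl⟩)

theorem mem_varsSubmodule_of_X_smul_mem (hi : i ∉ T)
    (hv : (X i : MvPolynomial τ R) • v ∈ varsSubmodule R ι T) : v ∈ varsSubmodule R ι T := by
  rw [mem_varsSubmodule_iff_support] at hv ⊢
  intro b a ha
  obtain ⟨t, ht, hat⟩ := hv b (Finsupp.single i 1 + a) (by
    rwa [Pi.smul_apply, smul_eq_mul, mem_support_iff, coeff_X_mul, ← mem_support_iff])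
  have hti : t ≠ i := fun h => hi (h ▸ ht)
  exact ⟨t, ht, by simpa [Finsupp.single_eq_of_ne hti] using hat⟩

theorem IsHomogeneousVec.mem_varsSubmodule_univ (hv : IsHomogeneousVec d e v)
    (hd : ∀ b, d b < e) : v ∈ varsSubmodule R ι Set.univ := by
  rw [mem_varsSubmodule_iff_support]
  intro b a ha
  have ha0 : a ≠ 0 := by
    rintro rfl
    exact (hd b).ne (by simpa using hv b 0 ha)
  obtain ⟨i, hi⟩ := Finsupp.ne_iff.1 ha0
  exact ⟨i, Set.mem_univ i, hi⟩

theorem single_one_notMem_varsSubmodule [Nontrivial R] [DecidableEq ι] (b : ι) (T : Set τ) :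
    Pi.single b 1 ∉ varsSubmodule R ι T := by
  intro h
  obtain ⟨i, -, hi⟩ := mem_varsSubmodule_iff_support.1 h b 0 (by simp)
  exact hi rfl

theorem gradedComp_mem_varsSubmodule (hv : v ∈ varsSubmodule R ι T) (d : ι → ℕ) (e : ℕ) :
    gradedComp d e v ∈ varsSubmodule R ι T := by
  rw [mem_varsSubmodule_iff_support] at hv ⊢
  intro b a ha
  refine hv b a ?_
  rw [mem_support_iff, coeff_gradedComp] at ha
  exact mem_support_iff.2 (ne_of_eq_of_ne (if_pos (of_not_not fun h => ha (if_neg h))).symm ha)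

theorem IsHomogeneousVec.exists_eq_X_smul_add (hv : IsHomogeneousVec d (e + 1) v)
    (hmem : v ∈ varsSubmodule R ι (insert i T)) :
    ∃ f, IsHomogeneousVec d e f ∧ ∃ s ∈ varsSubmodule R ι T,
      v = (X i : MvPolynomial τ R) • f + s := by
  simp only [mem_varsSubmodule, Set.image_insert_eq, Ideal.mem_span_insert] at hmem
  choose f s hs hfs using hmem
  refine ⟨gradedComp d e f, isHomogeneousVec_gradedComp d e f, gradedComp d (e + 1) s,
    gradedComp_mem_varsSubmodule (mem_varsSubmodule.2 hs) d (e + 1), ?_⟩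
  have hv_eq : v = (X i : MvPolynomial τ R) • f + s := funext fun b => by
    rw [hfs b, Pi.add_apply, Pi.smul_apply, smul_eq_mul, mul_comm]
  rw [← gradedComp_X_smul, ← map_add, ← hv_eq, isHomogeneousVec_iff_gradedComp_eq.1 hv]

/-- The sequence `x` of variables is regular on `⨁_b S(-d b) / N` in degrees `≥ q` (an almost
regular sequence): modulo `N` and the variables preceding `x k`, multiplication by `x k` is
injective on homogeneous elements of these degrees. -/
def AlmostRegularFrom {m : ℕ} (x : Fin m → τ) (d : ι → ℕ)
    (N : Submodule (MvPolynomial τ R) (ι → MvPolynomial τ R)) (q : ℕ) : Prop :=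
  ∀ (k : Fin m) (e : ℕ) (v : ι → MvPolynomial τ R), q ≤ e → IsHomogeneousVec d e v →
    (X (x k) : MvPolynomial τ R) • v ∈ N ⊔ varsSubmodule R ι (x '' Set.Iio k) →
    v ∈ N ⊔ varsSubmodule R ι (x '' Set.Iio k)

end CommSemiring

section CommRing

variable [CommRing R] {d : ι → ℕ} {e : ℕ} {v w : ι → MvPolynomial τ R}

theorem IsHomogeneousVec.sub (hv : IsHomogeneousVec d e v) (hw : IsHomogeneousVec d e w) :
    IsHomogeneousVec d e (v - w) := by
  rw [isHomogeneousVec_iff_gradedComp_eq] at *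
  rw [map_sub, hv, hw]

theorem map_mem_varsSubmodule [Finite ι] {T : Set τ} (hv : v ∈ varsSubmodule R ι T)
    (φ : (ι → MvPolynomial τ R) →ₗ[MvPolynomial τ R] (κ → MvPolynomial τ R)) :
    φ v ∈ varsSubmodule R κ T :=
  mem_varsSubmodule.2 (Ideal.map_pi _ v (mem_varsSubmodule.1 hv) φ)

variable [Finite ι] [DecidableEq ι] {dG : ι → ℕ} {dF : κ → ℕ}
  {φ : (ι → MvPolynomial τ R) →ₗ[MvPolynomial τ R] (κ → MvPolynomial τ R)}
  {T : Set τ} {i : τ} {m : ℕ} {x : Fin m → τ} {q : ℕ}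

theorem IsHomogeneousMap.exists_sub_mem_varsSubmodule (hφ : IsHomogeneousMap dG dF φ)
    {f : κ → MvPolynomial τ R} (hf : IsHomogeneousVec dF e f)
    (hmem : f ∈ LinearMap.range φ ⊔ varsSubmodule R κ T) :
    ∃ w, IsHomogeneousVec dG e w ∧ f - φ w ∈ varsSubmodule R κ T := by
  obtain ⟨_, ⟨w, rfl⟩, s, hs, hws⟩ := Submodule.mem_sup.1 hmem
  refine ⟨gradedComp dG e w, isHomogeneousVec_gradedComp dG e w, ?_⟩
  have hsub : f - φ (gradedComp dG e w) = gradedComp dF e s := by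
    rw [hφ.map_gradedComp, ← isHomogeneousVec_iff_gradedComp_eq.1 hf, ← hws, map_add,
      add_sub_cancel_left]
  exact hsub ▸ gradedComp_mem_varsSubmodule hs dF e

theorem IsHomogeneousMap.mem_ker_sup_varsSubmodule_insert (hφ : IsHomogeneousMap dG dF φ)
    (hreg : ∀ f, IsHomogeneousVec dF e f →
      (X i : MvPolynomial τ R) • f ∈ LinearMap.range φ ⊔ varsSubmodule R κ T →
      f ∈ LinearMap.range φ ⊔ varsSubmodule R κ T)
    (hT : ∀ g, IsHomogeneousVec dG (e + 1) g → φ g ∈ varsSubmodule R κ T →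
      g ∈ LinearMap.ker φ ⊔ varsSubmodule R ι T)
    {g : ι → MvPolynomial τ R} (hg : IsHomogeneousVec dG (e + 1) g)
    (hφg : φ g ∈ varsSubmodule R κ (insert i T)) :
    g ∈ LinearMap.ker φ ⊔ varsSubmodule R ι (insert i T) := by
  -- Write `φ g = x_i f + s`; as `f` is some `φ w` modulo `T`, `g - x_i w` is covered by `hT`.
  obtain ⟨f, hf, s, hs, hfs⟩ := (hφ.isHomogeneousVec_map hg).exists_eq_X_smul_add hφg
  have hf_mem : f ∈ LinearMap.range φ ⊔ varsSubmodule R κ T := by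
    refine hreg f hf ?_
    rw [eq_sub_of_add_eq hfs.symm]
    exact sub_mem (Submodule.mem_sup_left ⟨g, rfl⟩) (Submodule.mem_sup_right hs)
  obtain ⟨w, hw, hfw⟩ := hφ.exists_sub_mem_varsSubmodule hf hf_mem
  have hφ_sub : φ (g - (X i : MvPolynomial τ R) • w) =
      (X i : MvPolynomial τ R) • (f - φ w) + s := by
    rw [map_sub, map_smul, hfs, smul_sub]
    abel
  have hg_sub : g - (X i : MvPolynomial τ R) • w ∈ LinearMap.ker φ ⊔ varsSubmodule R ι T :=
    hT _ (hg.sub (hw.X_smul i)) (hφ_sub ▸ add_mem (Submodule.smul_mem _ _ hfw) hs)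
  rw [← sub_add_cancel g ((X i : MvPolynomial τ R) • w)]
  exact add_mem (sup_le_sup_left (varsSubmodule_mono (Set.subset_insert i T)) _ hg_sub)
    (Submodule.mem_sup_right (X_smul_mem_varsSubmodule (Set.mem_insert i T) w))

theorem AlmostRegularFrom.mem_ker_sup_varsSubmodule
    (hreg : AlmostRegularFrom x dF (LinearMap.range φ) q) (hφ : IsHomogeneousMap dG dF φ)
    (he : q ≤ e) (k : Fin (m + 1)) {g : ι → MvPolynomial τ R}
    (hg : IsHomogeneousVec dG (e + 1) g)
    (hφg : φ g ∈ varsSubmodule R κ (x '' {j | j.castSucc < k})) :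
    g ∈ LinearMap.ker φ ⊔ varsSubmodule R ι (x '' {j | j.castSucc < k}) := by
  induction k using Fin.induction generalizing g with
  | zero =>
    simpa [varsSubmodule_empty] using hφg
  | succ k ih =>
    have hprev : {j : Fin m | j.castSucc < k.castSucc} = Set.Iio k := by ext; simp
    have hnext : {j : Fin m | j.castSucc < k.succ} = insert k (Set.Iio k) := by
      rw [Set.Iio_insert]
      ext
      simp [Fin.castSucc_lt_succ_iff]
    rw [hprev] at ih
    rw [hnext, Set.image_insert_eq] at hφg ⊢
    exact hφ.mem_ker_sup_varsSubmodule_insert (fun f => hreg k e f he) (fun g => ih) hg hφg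

theorem AlmostRegularFrom.ker (hreg : AlmostRegularFrom x dF (LinearMap.range φ) q)
    (hφ : IsHomogeneousMap dG dF φ) (hx : Function.Injective x) :
    AlmostRegularFrom x dG (LinearMap.ker φ) (q + 1) := by
  intro k e v he hv hXv
  obtain ⟨e, rfl⟩ := Nat.exists_eq_add_of_le' (Nat.le_of_add_left_le he)
  have hφv : φ v ∈ varsSubmodule R κ (x '' Set.Iio k) := by
    refine mem_varsSubmodule_of_X_smul_mem (i := x k) ?_ ?_
    · simp [hx.eq_iff]
    · obtain ⟨u, hu, s, hs, hus⟩ := Submodule.mem_sup.1 hXv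
      rw [← map_smul, ← hus, map_add, LinearMap.mem_ker.1 hu, zero_add]
      exact map_mem_varsSubmodule hs φ
  have hIio : {j : Fin m | j.castSucc < k.castSucc} = Set.Iio k := by ext; simp
  have hv_mem := hreg.mem_ker_sup_varsSubmodule hφ (Nat.le_of_add_le_add_right he) k.castSucc hv
  rw [hIio] at hv_mem
  exact hv_mem hφv

theorem AlmostRegularFrom.degree_le [Nontrivial R]
    (hreg : AlmostRegularFrom x dF (LinearMap.range φ) q) (hφ : IsHomogeneousMap dG dF φ)
    (hx : Function.Surjective x) (hdF : ∀ c, dF c ≤ q)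
    (hmin : LinearMap.ker φ ≤ varsSubmodule R ι Set.univ) (b : ι) : dG b ≤ q := by
  by_contra! hqb
  obtain ⟨e, he⟩ := Nat.exists_eq_add_of_le' (Nat.one_le_of_lt hqb)
  have hφb : φ (Pi.single b 1) ∈ varsSubmodule R κ Set.univ :=
    (hφ b).mem_varsSubmodule_univ fun c => (hdF c).trans_lt hqb
  have hlast : x '' {j | j.castSucc < Fin.last m} = Set.univ := by
    simpa [Fin.castSucc_lt_last] using hx.range_eq
  have hb := hreg.mem_ker_sup_varsSubmodule hφ (by omega) (Fin.last m)
    (he ▸ isHomogeneousVec_single dG b) (hlast ▸ hφb)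
  rw [hlast, sup_eq_right.2 hmin] at hb
  exact single_one_notMem_varsSubmodule b _ hb

end CommRing

end GradedFreeModule

section Resolution

variable {K : Type*} [Field K] {n : ℕ} {I : Ideal (MvPolynomial (Fin n) K)}

namespace MinGradedFreeRes

variable (F : MinGradedFreeRes I)

theorem range_pi_aug :
    LinearMap.range (LinearMap.pi fun _ : Unit => F.aug) = Submodule.pi Set.univ fun _ => I := by
  ext v
  have haug : v () ∈ I ↔ ∃ w, F.aug w = v () := by rw [← LinearMap.mem_range, F.range_aug]
  simp only [Submodule.mem_pi, Set.mem_univ, LinearMap.mem_range, funext_iff, LinearMap.pi_apply,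
    Unique.forall_iff, PUnit.default_eq_unit, haug]

theorem ker_pi_aug :
    LinearMap.ker (LinearMap.pi fun _ : Unit => F.aug) = LinearMap.range (F.diff 0) := by
  rw [LinearMap.ker_pi, iInf_const, LinearMap.exact_iff.1 F.exact_aug]

theorem range_diff_le_varsSubmodule (i : ℕ) :
    LinearMap.range (F.diff i) ≤ varsSubmodule K _ Set.univ := by
  rintro _ ⟨v, rfl⟩
  rw [mem_varsSubmodule, Set.image_univ]
  exact F.minimal i v

theorem deg_le_and_almostRegularFrom {m : ℕ} {x : Fin m → Fin n} (hx : Function.Bijective x)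
    {q : ℕ} (hreg : AlmostRegularFrom x (fun _ : Unit => 0) (Submodule.pi Set.univ fun _ => I) q)
    (i : ℕ) :
    (∀ b, F.deg i b ≤ q + i) ∧
      AlmostRegularFrom x (F.deg i) (LinearMap.range (F.diff i)) (q + i + 1) := by
  induction i with
  | zero =>
    have hφ : IsHomogeneousMap (F.deg 0) (fun _ : Unit => 0) (LinearMap.pi fun _ => F.aug) :=
      fun b _ a ha => (zero_add _).trans (F.aug_homogeneous b a ha)
    rw [← F.range_pi_aug] at hreg
    rw [← F.ker_pi_aug]
    exact ⟨hreg.degree_le hφ hx.surjective (fun _ => Nat.zero_le q)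
      (F.ker_pi_aug.trans_le (F.range_diff_le_varsSubmodule 0)), hreg.ker hφ hx.injective⟩
  | succ i ih =>
    obtain ⟨hdeg, hreg_i⟩ := ih
    have hφ : IsHomogeneousMap (F.deg (i + 1)) (F.deg i) (F.diff i) := F.diff_homogeneous i
    have hker := LinearMap.exact_iff.1 (F.exact_diff i)
    rw [← hker]
    exact ⟨hreg_i.degree_le hφ hx.surjective (fun c => (hdeg c).trans (Nat.le_succ _))
      (hker.trans_le (F.range_diff_le_varsSubmodule (i + 1))), hreg_i.ker hφ hx.injective⟩

end MinGradedFreeRes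

theorem regularity_le_of_forall_deg_le {q : ℕ}
    (hdeg : ∀ (F : MinGradedFreeRes I) (i : ℕ) (b : Fin (F.rank i)), F.deg i b ≤ q + i) :
    regularity I ≤ (((q : ℤ) : WithTop ℤ) : WithBot (WithTop ℤ)) := by
  refine sSup_le ?_
  rintro _ ⟨i, j, hij, rfl⟩
  rw [gradedBetti] at hij
  split_ifs at hij with hF
  · obtain ⟨b, hb⟩ := Finset.card_ne_zero.1 hij
    have hj : j ≤ q + i := (Finset.mem_filter.1 hb).2 ▸ hdeg hF.some i b
    rw [WithBot.coe_le_coe, WithTop.coe_le_coe]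
    omega
  · exact absurd rfl hij

end Resolution

section Saturation

variable {R : Type*} [CommRing R]

theorem mem_saturation_iff {I J : Ideal R} (hJ : J.FG) {f : R} :
    f ∈ saturation I J ↔ J ≤ (I.colon {f}).radical := by
  have hmono : Monotone fun k : ℕ => Submodule.colon I ((J ^ k : Ideal R) : Set R) :=
    fun k l hkl => Submodule.colon_mono le_rfl (Ideal.pow_le_pow_right hkl)
  have hcolon : ∀ k : ℕ, f ∈ Submodule.colon I ((J ^ k : Ideal R) : Set R) ↔
      J ^ k ≤ I.colon {f} := by
    intro k
    rw [Submodule.mem_colon]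
    refine forall₂_congr fun z _ => ?_
    rw [Submodule.mem_colon_singleton, smul_eq_mul, smul_eq_mul, mul_comm]
  rw [saturation, Submodule.mem_iSup_of_directed _ hmono.directed_le]
  simp only [hcolon]
  exact ⟨fun ⟨k, hk⟩ z hz => ⟨k, hk (Ideal.pow_mem_pow hz k)⟩,
    fun h => Ideal.exists_pow_le_of_le_radical_of_fg h hJ⟩

theorem minimalPrimes_colon_singleton_subset_associatedPrimes [IsNoetherianRing R] {M : Type*}
    [AddCommGroup M] [Module R M] (N : Submodule R M) (m : M) :
    (N.colon {m}).minimalPrimes ⊆ associatedPrimes R (M ⧸ N) := by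
  intro P hP
  obtain ⟨z, hz⟩ := Submodule.exists_eq_colon_of_mem_minimalPrimes hP
  rw [AssociatedPrimes.mem_iff, isAssociatedPrime_iff]
  refine ⟨hP.1.1, N.mkQ z, ?_⟩
  rw [hz]
  ext r
  rw [Submodule.mem_colon_singleton, Submodule.mem_colon_singleton, ← map_smul, Submodule.mem_bot,
    Submodule.mkQ_apply, Submodule.Quotient.mk_eq_zero]

theorem mem_radical_colon_of_associatedPrimes [IsNoetherianRing R] {M : Type*} [AddCommGroup M]
    [Module R M] {N : Submodule R M} {m : M} {x y : R}
    (hxy : ∀ P ∈ associatedPrimes R (M ⧸ N), x ∈ P → y ∈ P)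
    (hx : x ∈ (N.colon {m}).radical) : y ∈ (N.colon {m}).radical := by
  rw [← Ideal.sInf_minimalPrimes, Submodule.mem_sInf] at hx ⊢
  exact fun P hP =>
    hxy P (minimalPrimes_colon_singleton_subset_associatedPrimes N m hP) (hx P hP)

end Saturation

theorem exists_perm_monotone_of_isChain {α : Type*} [PartialOrder α] {n : ℕ} {f : Fin n → α}
    (hf : IsChain (· ≤ ·) (Set.range f)) : ∃ σ : Equiv.Perm (Fin n), Monotone (f ∘ σ) := by
  classical
  let _ := hf.linearOrder
  exact ⟨Tuple.sort (Set.rangeFactorization f), Tuple.monotone_sort (Set.rangeFactorization f)⟩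

section BorelType

variable {K : Type*} [Field K] {n : ℕ} {I : Ideal (MvPolynomial (Fin n) K)}

theorem isBorelType_iff :
    IsBorelType I ↔ ∀ i j : Fin n, i ≤ j → ∀ f : MvPolynomial (Fin n) K,
      X j ∈ (I.colon {f}).radical → X i ∈ (I.colon {f}).radical := by
  simp only [IsBorelType, SetLike.ext_iff, mem_saturation_iff (IsNoetherian.noetherian _),
    Ideal.span_le, Set.subset_def, Set.mem_singleton_iff, forall_eq, Set.forall_mem_image,
    Set.mem_ofPred_eq, SetLike.mem_coe]
  exact ⟨fun h i j hij f hf => (h j f).1 hf hij,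
    fun h j f => ⟨fun hf i hij => h i j hij f hf, fun hf => hf le_rfl⟩⟩

theorem mem_map_rename_iff {R τ υ : Type*} [CommSemiring R] {I : Ideal (MvPolynomial τ R)}
    (σ : τ ≃ υ) {f : MvPolynomial υ R} :
    f ∈ I.map (rename σ : _ →ₐ[R] MvPolynomial υ R) ↔ rename σ.symm f ∈ I := by
  refine (Ideal.mem_map_of_equiv (renameEquiv R σ) f).trans ?_
  exact ⟨fun ⟨z, hz, h⟩ => h ▸ by simpa [rename_rename] using hz,
    fun h => ⟨_, h, by simp [rename_rename]⟩⟩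

theorem isBorelType_map_rename_iff (σ : Equiv.Perm (Fin n)) :
    IsBorelType (I.map (rename σ : _ →ₐ[K] MvPolynomial (Fin n) K)) ↔
      ∀ i j : Fin n, i ≤ j → ∀ f : MvPolynomial (Fin n) K,
        X (σ.symm j) ∈ (I.colon {f}).radical → X (σ.symm i) ∈ (I.colon {f}).radical := by
  have hrad : ∀ (j : Fin n) (f : MvPolynomial (Fin n) K),
      X j ∈ ((I.map (rename σ : _ →ₐ[K] MvPolynomial (Fin n) K)).colon {f}).radical ↔
      X (σ.symm j) ∈ (I.colon {rename σ.symm f}).radical := fun j f => by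
    simp only [Ideal.mem_radical_iff, Submodule.mem_colon_singleton, smul_eq_mul,
      mem_map_rename_iff, map_mul, map_pow, rename_X]
  simp only [isBorelType_iff, hrad]
  exact forall₃_congr fun i j _ => ((renameEquiv K σ.symm).surjective.forall
    (p := fun f => X (σ.symm j) ∈ (I.colon {f}).radical →
      X (σ.symm i) ∈ (I.colon {f}).radical)).symm

theorem exists_perm_isBorelType_map_rename
    (hAss : IsChain (· ≤ ·)
      (associatedPrimes (MvPolynomial (Fin n) K) (MvPolynomial (Fin n) K ⧸ I))) :
    ∃ σ : Equiv.Perm (Fin n),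
      IsBorelType (I.map (rename σ : _ →ₐ[K] MvPolynomial (Fin n) K)) := by
  let avoiding : Fin n → Set (Ideal (MvPolynomial (Fin n) K)) := fun i =>
    {P ∈ associatedPrimes _ (MvPolynomial (Fin n) K ⧸ I) | X i ∉ P}
  have havoiding : IsChain (· ≤ ·) (Set.range avoiding) := by
    rintro _ ⟨i, rfl⟩ _ ⟨j, rfl⟩ -
    by_contra! h
    obtain ⟨P, ⟨hP, hiP⟩, hjP⟩ := Set.not_subset.1 h.1
    obtain ⟨Q, ⟨hQ, hjQ⟩, hiQ⟩ := Set.not_subset.1 h.2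
    have hjP : X j ∈ P := of_not_not fun h => hjP ⟨hP, h⟩
    have hiQ : X i ∈ Q := of_not_not fun h => hiQ ⟨hQ, h⟩
    exact (hAss.total hP hQ).elim (fun hPQ => hjQ (hPQ hjP)) fun hQP => hiP (hQP hiQ)
  obtain ⟨σ, hσ⟩ := exists_perm_monotone_of_isChain havoiding
  refine ⟨σ.symm, (isBorelType_map_rename_iff _).2 fun i j hij f => ?_⟩
  exact mem_radical_colon_of_associatedPrimes fun P hP hjP =>
    of_not_not fun hiP => (hσ hij ⟨hP, hiP⟩).2 hjP

end BorelType

section Monomial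

variable {K : Type*} [Field K] {n : ℕ} {I J : Ideal (MvPolynomial (Fin n) K)}

theorem monomial_mem_of_le {R τ : Type*} [CommSemiring R] {I : Ideal (MvPolynomial τ R)}
    {a g : τ →₀ ℕ} (hg : monomial g (1 : R) ∈ I) (h : g ≤ a) : monomial a (1 : R) ∈ I := by
  rw [← tsub_add_cancel_of_le h, ← one_mul (1 : R), ← monomial_mul]
  exact Ideal.mul_mem_left _ _ hg

theorem monomial_mem_of_mem_minGens {g : Fin n →₀ ℕ} (hg : g ∈ minGens I) :
    monomial g (1 : K) ∈ I :=
  Minimal.prop (P := fun b : Fin n →₀ ℕ => monomial b (1 : K) ∈ I) hg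

theorem exists_minGens_le {a : Fin n →₀ ℕ} (ha : monomial a (1 : K) ∈ I) :
    ∃ g ∈ minGens I, g ≤ a := by
  obtain ⟨g, hga, hg⟩ := exists_minimal_le_of_wellFoundedLT
    (fun b : Fin n →₀ ℕ => monomial b (1 : K) ∈ I) a ha
  exact ⟨g, hg, hga⟩

theorem degree_le_genDeg {g : Fin n →₀ ℕ} (hg : g ∈ minGens I) : g.degree ≤ genDeg I :=
  Finset.le_sup (f := fun a : Fin n →₀ ℕ => a.degree) ((minGens_finite I).mem_toFinset.2 hg)

theorem lt_maxVarIdeal {g : Fin n →₀ ℕ} (hg : g ∈ minGens I) {j : Fin n} (hj : g j ≠ 0) :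
    (j : ℕ) < maxVarIdeal I :=
  (Finset.le_sup (f := fun i : Fin n => (i : ℕ) + 1) (Finsupp.mem_support_iff.2 hj)).trans
    (Finset.le_sup (f := maxVar) ((minGens_finite I).mem_toFinset.2 hg))

theorem maxVarIdeal_eq_zero_of_genDeg_eq_zero (h : genDeg I = 0) : maxVarIdeal I = 0 := by
  refine Nat.eq_zero_of_le_zero (Finset.sup_le fun g hg => ?_)
  have hg0 : g = 0 := by
    rw [← Finsupp.degree_eq_zero_iff, ← Nat.le_zero, ← h]
    exact degree_le_genDeg ((minGens_finite I).mem_toFinset.1 hg)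
  simp [hg0, maxVar]

theorem exists_minGens_lt_of_X_mem_radical {a : Fin n →₀ ℕ} (ha : monomial a (1 : K) ∉ I)
    {j : Fin n} (hj : X j ∈ (I.colon {monomial a (1 : K)}).radical) :
    ∃ g ∈ minGens I, a j < g j := by
  obtain ⟨N, hN⟩ := hj
  rw [Submodule.mem_colon_singleton, smul_eq_mul, X_pow_eq_monomial, monomial_mul, one_mul] at hN
  obtain ⟨g, hg, hle⟩ := exists_minGens_le hN
  refine ⟨g, hg, ?_⟩
  by_contra! hgj
  refine ha (monomial_mem_of_le (monomial_mem_of_mem_minGens hg) fun t => ?_)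
  obtain rfl | htj := eq_or_ne t j
  · exact hgj
  · simpa [Finsupp.single_eq_of_ne htj] using hle t

theorem degree_le_of_forall_X_mem_radical {a : Fin n →₀ ℕ} (ha : monomial a (1 : K) ∉ I)
    (hX : ∀ j ∈ a.support, X j ∈ (I.colon {monomial a (1 : K)}).radical) :
    a.degree ≤ maxVarIdeal I * (genDeg I - 1) := by
  have hgen : ∀ j ∈ a.support, ∃ g ∈ minGens I, a j < g j := fun j hj =>
    exists_minGens_lt_of_X_mem_radical ha (hX j hj)
  have hcard : a.support.card ≤ maxVarIdeal I := by
    rw [← Finset.card_range (maxVarIdeal I)]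
    refine Finset.card_le_card_of_injOn Fin.val (fun j hj => ?_) Fin.val_injective.injOn
    obtain ⟨g, hg, hlt⟩ := hgen j hj
    exact Finset.mem_coe.2 (Finset.mem_range.2 (lt_maxVarIdeal hg (Nat.ne_zero_of_lt hlt)))
  have hexp : ∀ j ∈ a.support, a j ≤ genDeg I - 1 := fun j hj => by
    obtain ⟨g, hg, hlt⟩ := hgen j hj
    exact Nat.le_sub_one_of_lt (hlt.trans_le ((Finsupp.le_degree j g).trans (degree_le_genDeg hg)))
  calc a.degree = ∑ j ∈ a.support, a j := rfl
    _ ≤ a.support.card * (genDeg I - 1) := Finset.sum_le_card_nsmul _ _ _ hexp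
    _ ≤ maxVarIdeal I * (genDeg I - 1) := Nat.mul_le_mul_right _ hcard

theorem isMonomialIdeal_span_X_image (T : Set (Fin n)) :
    IsMonomialIdeal (Ideal.span (X '' T : Set (MvPolynomial (Fin n) K))) :=
  ⟨(fun t => Finsupp.single t 1) '' T, by rw [Set.image_image]; rfl⟩

theorem IsMonomialIdeal.mem_sup_iff (hI : IsMonomialIdeal I) (hJ : IsMonomialIdeal J)
    {f : MvPolynomial (Fin n) K} :
    f ∈ I ⊔ J ↔ ∀ a ∈ f.support, monomial a (1 : K) ∈ I ∨ monomial a (1 : K) ∈ J := by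
  classical
  obtain ⟨A, rfl⟩ := hI
  obtain ⟨B, rfl⟩ := hJ
  simp only [← Ideal.span_union, ← Set.image_union, mem_ideal_span_monomial_image, Set.mem_union,
    or_and_right, exists_or, support_monomial, one_ne_zero, if_false, Finset.mem_singleton,
    forall_eq]

theorem monomial_mem_span_X_image_iff {R τ : Type*} [CommSemiring R] [Nontrivial R] {T : Set τ}
    {a : τ →₀ ℕ} :
    monomial a (1 : R) ∈ Ideal.span (X '' T : Set (MvPolynomial τ R)) ↔ ∃ t ∈ T, a t ≠ 0 := by
  classical
  simp only [mem_ideal_span_X_image, support_monomial, one_ne_zero, if_false, Finset.mem_singleton,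
    forall_eq]

theorem IsMonomialIdeal.almostRegularFrom (hI : IsMonomialIdeal I) {m : ℕ} {x : Fin m → Fin n}
    (hx : Function.Bijective x)
    (hBorel : ∀ k l, k ≤ l → ∀ f : MvPolynomial (Fin n) K,
      X (x k) ∈ (I.colon {f}).radical → X (x l) ∈ (I.colon {f}).radical) :
    AlmostRegularFrom x (fun _ : Unit => 0) (Submodule.pi Set.univ fun _ => I)
      (maxVarIdeal I * (genDeg I - 1) + 1) := by
  intro k e v he hv hXv
  rw [pi_sup_varsSubmodule, Submodule.mem_pi] at hXv ⊢
  intro u hu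
  have hXvu := (hI.mem_sup_iff (isMonomialIdeal_span_X_image _)).1 (hXv u hu)
  refine (hI.mem_sup_iff (isMonomialIdeal_span_X_image _)).2 fun a ha => ?_
  by_contra! hnot
  obtain ⟨haI, haT⟩ := hnot
  simp only [monomial_mem_span_X_image_iff, not_exists, not_and, not_not] at haT
  have hXk : X (x k) ∈ (I.colon {monomial a (1 : K)}).radical := by
    have hsupp : Finsupp.single (x k) 1 + a ∈ (X (x k) * v u).support := by
      rwa [mem_support_iff, coeff_X_mul, ← mem_support_iff]
    obtain hmem | ⟨t, ⟨l, hlk, rfl⟩, hl⟩ :=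
      (hXvu _ hsupp).imp_right monomial_mem_span_X_image_iff.1
    · refine Ideal.le_radical ?_
      rwa [Submodule.mem_colon_singleton, smul_eq_mul, X, monomial_mul, one_mul]
    · have hne : x l ≠ x k := hx.injective.ne (ne_of_lt hlk)
      rw [Finsupp.add_apply, Finsupp.single_eq_of_ne hne, zero_add] at hl
      exact absurd (haT _ ⟨l, hlk, rfl⟩) hl
  have hdeg := degree_le_of_forall_X_mem_radical haI fun j hj => by
    obtain ⟨l, rfl⟩ := hx.surjective j
    refine hBorel k l (not_lt.1 fun hlk => ?_) _ hXk
    exact Finsupp.mem_support_iff.1 hj (haT _ ⟨l, hlk, rfl⟩)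
  have hae : 0 + a.degree = e := hv u a ha
  omega

theorem IsMonomialIdeal.regularity_le_of_isBorelType_map_rename (hI : IsMonomialIdeal I)
    {σ : Equiv.Perm (Fin n)}
    (hσ : IsBorelType (I.map (rename σ : _ →ₐ[K] MvPolynomial (Fin n) K))) :
    regularity I ≤ ((((maxVarIdeal I : ℤ) * ((genDeg I : ℤ) - 1) + 1 : ℤ) : WithTop ℤ) :
      WithBot (WithTop ℤ)) := by
  let x : Fin n → Fin n := σ.symm ∘ Fin.rev
  have hx : Function.Bijective x := σ.symm.bijective.comp Fin.rev_bijective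
  have hreg := hI.almostRegularFrom hx fun k l hkl =>
    (isBorelType_map_rename_iff σ).1 hσ l.rev k.rev (Fin.rev_le_rev.2 hkl)
  refine (regularity_le_of_forall_deg_le fun F i =>
    (F.deg_le_and_almostRegularFrom hx hreg i).1).trans_eq ?_
  congr 2
  -- If `deg(I) = 0`, the truncated `genDeg I - 1` differs from `deg(I) - 1`, but then `m(I) = 0`.
  obtain h0 | hpos := Nat.eq_zero_or_pos (genDeg I)
  · simp [h0, maxVarIdeal_eq_zero_of_genDeg_eq_zero h0]
  · push_cast [Nat.cast_sub hpos]
    simp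

end Monomial

end BorelReg

theorem corollary2p5 {K : Type*} [Field K] {n : ℕ} (I : Ideal (MvPolynomial (Fin n) K))
    (hI : BorelReg.IsMonomialIdeal I)
    (hAss : IsChain (· ≤ ·)
      (associatedPrimes (MvPolynomial (Fin n) K) (MvPolynomial (Fin n) K ⧸ I))) :
    (∃ σ : Equiv.Perm (Fin n),
      BorelReg.IsBorelType (I.map (MvPolynomial.rename σ : _ →ₐ[K] MvPolynomial (Fin n) K))) ∧
    BorelReg.regularity I ≤
      ((((BorelReg.maxVarIdeal I : ℤ) * ((BorelReg.genDeg I : ℤ) - 1) + 1 : ℤ) : WithTop ℤ) :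
        WithBot (WithTop ℤ)) := by
  obtain ⟨σ, hσ⟩ := BorelReg.exists_perm_isBorelType_map_rename hAss
  exact ⟨⟨σ, hσ⟩, hI.regularity_le_of_isBorelType_map_rename hσ⟩
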